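/- Consider the 4-chain query $\mathcal Q_{\mathsf{chain}}=\pi_{A,E}\,R_1(A,B)\Join R_2(B,C)\Join R_3(C,D)\Join R_4(D,E)$, whose result on an instance $\mathcal R=(R_1,R_2,R_3,R_4)$ of finite binary relations is the set of pairs $(a,e)$ such that $(a,b)\in R_1$, $(b,c)\in R_2$, $(c,d)\in R_3$, $(d,e)\in R_4$ for some $b,c,d$. The input size is $N=\sum_i|R_i|$ and the output size is $\mathrm{OUT}=|\mathcal Q_{\mathsf{chain}}(\mathcal R)|$. In the property testing model a randomized algorithm accesses the instance only through the following unit-time primitives on a relation $R_i$: draw a uniformly random tuple of $R_i$; for a tuple $t$ on a subset of the attributes of $R_i$, return the number of tuples of $R_i$ that match $t$; for such $t$ and an integer $j$, return the $j$-th tuple of $R_i$ that matches $t$ in a fixed (arbitrary) stored ordering; test whether a given tuple belongs to $R_i$. Every local computation step and every draw of a uniform random integer from an interval also takes unit time. An $\epsilon$-approximation of $V\ge 0$ is a number $\widehat V$ with $(1-\epsilon)V\le\widehat V\le(1+\epsilon)V$. Theorem. For all constants $0<\epsilon<1$, $0<\delta<1$ and $\kappa<\tfrac14$ there are $c>0$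 and $N_0$ such that the following holds for every $N\ge N_0$ and all attribute domains with at least $N$ elements each. Let $\mathcal A$ be any randomized algorithm in the property testing model that, on every instance of input size $N$ with non-empty query result, returns an $\epsilon$-approximation of $|\mathcal Q_{\mathsf{chain}}(\mathcal R)|$ with probability at least $1-\delta$. Then for every integer $\mathrm{OUT}$ with $1\le\mathrm{OUT}\le\kappa N^2$ there is an instance (with stored orderings) of input size exactly $N$ and output size exactly $\mathrm{OUT}$ on which the expected running time of $\mathcal A$ is at least $cN$. That is, $\Omega(N)$ time is required for every $\mathrm{OUT}$. -/

import Mathlib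

open scoped ENNReal

/-- The tuple `t = (a, b)` over two attributes agrees with a tuple defined on a subset of
these attributes: `x = none` means that the first attribute is not specified, and likewise
for `y`. -/
def Agrees {α β : Type} (x : Option α) (y : Option β) (t : α × β) : Prop :=
  (∀ a, x = some a → t.1 = a) ∧ (∀ b, y = some b → t.2 = b)

/-- A binary relation, stored so that the matches of every partial tuple `(x, y)` can be
accessed by position. The relation is the finite set `tuples`; `list x y` is the fixed ordering
(an arbitrary one) of the tuples that agree with `(x, y)`. -/
structure StoredRelation (α β : Type) where
  tuples : Finset (α × β)
  list : Option α → Option β → List (α × β)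
  nodup_list : ∀ x y, (list x y).Nodup
  mem_list : ∀ x y t, t ∈ list x y ↔ t ∈ tuples ∧ Agrees x y t

/-- The primitives of the property testing model on one binary relation. -/
inductive Primitive (α β : Type) : Type
  /-- sample tuple -/
  | sample
  /-- compute degree of the partial tuple `(x, y)` -/
  | degree (x : Option α) (y : Option β)
  /-- access the neighbor number `j` (counted from 0) of the partial tuple `(x, y)` -/
  | neighbor (x : Option α) (y : Option β) (j : ℕ)
  /-- test tuple -/
  | test (t : α × β)

/-- The type of the answers to a primitive. -/
def Primitive.Answer {α β : Type} : Primitive α β → Type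
  | .sample => Option (α × β)
  | .degree _ _ => ℕ
  | .neighbor _ _ _ => Option (α × β)
  | .test _ => Bool

open Classical in
/-- The (distribution of the) answer of a stored relation to a primitive. Sampling returns a
uniform tuple (`none` if the relation is empty), independently of everything before.
Accessing a neighbor returns the whole matching tuple, which carries the same information as its
projection to the unspecified attributes, and `none` if there are at most `j` matching tuples. -/
noncomputable def StoredRelation.answer {α β : Type} (R : StoredRelation α β) :
    (q : Primitive α β) → PMF q.Answer
  | .sample =>
      if h : R.tuples.Nonempty then (PMF.uniformOfFinset R.tuples h).map some
      else PMF.pure none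
  | .degree x y => PMF.pure (R.tuples.filter fun t => Agrees x y t).card
  | .neighbor x y j => PMF.pure (R.list x y)[j]?
  | .test t => PMF.pure (decide (t ∈ R.tuples))

/-- An instance of the 4-chain query, with attributes ranging over the domains
`A, B, C, D, E`. -/
structure ChainInstance (A B C D E : Type) where
  R₁ : StoredRelation A B
  R₂ : StoredRelation B C
  R₃ : StoredRelation C D
  R₄ : StoredRelation D E

namespace ChainInstance

variable {A B C D E : Type}

/-- The input size: the total number of tuples. -/
def inputSize (I : ChainInstance A B C D E) : ℕ :=
  I.R₁.tuples.card + I.R₂.tuples.card + I.R₃.tuples.card + I.R₄.tuples.card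

/-- The result of the query `π_{A,E} R₁(A,B) ⋈ R₂(B,C) ⋈ R₃(C,D) ⋈ R₄(D,E)`. -/
def result (I : ChainInstance A B C D E) : Set (A × E) :=
  {p | ∃ b c d, (p.1, b) ∈ I.R₁.tuples ∧ (b, c) ∈ I.R₂.tuples ∧
    (c, d) ∈ I.R₃.tuples ∧ (d, p.2) ∈ I.R₄.tuples}

/-- The result of the query is a finite set. -/
theorem result_finite (I : ChainInstance A B C D E) : I.result.Finite := by
  classical
  refine ((I.R₁.tuples.image Prod.fst ×ˢ I.R₄.tuples.image Prod.snd).finite_toSet).subset ?_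
  rintro ⟨a, e⟩ ⟨b, c, d, h1, -, -, h4⟩
  simp only [Finset.coe_product, Finset.coe_image, Set.mem_prod, Set.mem_image]
  exact ⟨⟨_, h1, rfl⟩, ⟨_, h4, rfl⟩⟩

/-- The output size: the number of tuples in the query result. -/
noncomputable def outputSize (I : ChainInstance A B C D E) : ℕ :=
  I.result.ncard

end ChainInstance

/-- One call of a primitive on one of the four relations of the 4-chain query. -/
inductive ChainPrimitive (A B C D E : Type) : Type
  | onR₁ (q : Primitive A B)
  | onR₂ (q : Primitive B C)
  | onR₃ (q : Primitive C D)
  | onR₄ (q : Primitive D E)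

/-- The type of the answers to a call. -/
def ChainPrimitive.Answer {A B C D E : Type} : ChainPrimitive A B C D E → Type
  | .onR₁ q => q.Answer
  | .onR₂ q => q.Answer
  | .onR₃ q => q.Answer
  | .onR₄ q => q.Answer

/-- The (distribution of the) answer of an instance to a call. -/
noncomputable def ChainInstance.answer {A B C D E : Type} (I : ChainInstance A B C D E) :
    (q : ChainPrimitive A B C D E) → PMF q.Answer
  | .onR₁ q => I.R₁.answer q
  | .onR₂ q => I.R₂.answer q
  | .onR₃ q => I.R₃.answer q
  | .onR₄ q => I.R₄.answer q

/-- What a machine with state space `σ` does in one unit of time: it stops with an output, or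
it makes a step of local computation, or it draws a uniform random integer from `[a, b]`, or it
calls a primitive; in the last two cases it continues according to the outcome. -/
inductive MachineAction (A B C D E σ : Type) : Type
  | halt (v : ℝ)
  | compute (s : σ)
  | randInt (a b : ℤ) (hab : a ≤ b) (k : ℤ → σ)
  | call (q : ChainPrimitive A B C D E) (k : q.Answer → σ)

/-- A randomized algorithm for the 4-chain query in the property testing model. Its state
(memory contents and program counter) ranges over an arbitrary type, and the transition is
arbitrary, so that every word RAM program with unit-cost instructions, with any word length, is
of this form. The input is accessible through the primitives only. -/
structure ChainAlgorithm (A B C D E : Type) where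
  State : Type
  init : State
  next : State → MachineAction A B C D E State

namespace ChainAlgorithm

variable {A B C D E : Type}

/-- One time unit of the execution on the instance `I`. A configuration is `Sum.inl s` while the
algorithm is running in state `s`, and `Sum.inr v` once it has stopped with output `v`. -/
noncomputable def step (𝒜 : ChainAlgorithm A B C D E) (I : ChainInstance A B C D E) :
    𝒜.State ⊕ ℝ → PMF (𝒜.State ⊕ ℝ)
  | .inr v => PMF.pure (.inr v)
  | .inl s =>
    match 𝒜.next s with
    | .halt v => PMF.pure (.inr v)
    | .compute s' => PMF.pure (.inl s')
    | .randInt a b hab k =>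
        (PMF.uniformOfFinset (Finset.Icc a b) (Finset.nonempty_Icc.mpr hab)).map
          fun z => .inl (k z)
    | .call q k => (I.answer q).map fun r => .inl (k r)

/-- The distribution of the configuration after `n` time units. -/
noncomputable def config (𝒜 : ChainAlgorithm A B C D E) (I : ChainInstance A B C D E) :
    ℕ → PMF (𝒜.State ⊕ ℝ)
  | 0 => PMF.pure (.inl 𝒜.init)
  | n + 1 => (𝒜.config I n).bind (𝒜.step I)

/-- The probability that the algorithm stops with an output in `S`: the supremum (which is the
limit) of the probabilities that it has done so within `n` time units. -/
noncomputable def outputProb (𝒜 : ChainAlgorithm A B C D E) (I : ChainInstance A B C D E)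
    (S : Set ℝ) : ℝ≥0∞ :=
  ⨆ n, (𝒜.config I n).toOuterMeasure (Sum.inr '' S)

/-- The expected running time, in the form `𝔼 T = ∑ₙ ℙ(T > n)`. -/
noncomputable def expectedTime (𝒜 : ChainAlgorithm A B C D E) (I : ChainInstance A B C D E) :
    ℝ≥0∞ :=
  ∑' n, (𝒜.config I n).toOuterMeasure (Set.range Sum.inl)

end ChainAlgorithm

/-- `v` is an `ε`-approximation of `V`. -/
def IsApproximation (ε V v : ℝ) : Prop :=
  (1 - ε) * V ≤ v ∧ v ≤ (1 + ε) * V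

/-- On every instance of input size `N` with a non-empty query result, the algorithm returns an
`ε`-approximation of the output size with probability at least `1 - δ`. -/
def ApproximatelyCounts {A B C D E : Type} (𝒜 : ChainAlgorithm A B C D E) (N : ℕ) (ε δ : ℝ) : Prop :=
  ∀ I : ChainInstance A B C D E, I.inputSize = N → 1 ≤ I.outputSize →
    ENNReal.ofReal (1 - δ) ≤ 𝒜.outputProb I {v | IsApproximation ε I.outputSize v}

/-! The lower bound hides one tuple. In a base instance, `blocks`, the elements of `A` are grouped
into blocks, each attached to one junction in `B`. Every junction has `m` private successors in `C`,
all dead ends, while `m` further elements of `C` reach every output endpoint but have no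
predecessor. Replacing a single tuple of the second relation, from a junction to a private successor
`x`, by one to a live element `y` connects the whole block of size `w i`. It changes the output size
to `w i * q + r` and keeps the input size.

A call notices the exchange only if it samples one of the two tuples or touches `x` or `y`. Averaged
over the `m ^ 2` pairs this has probability at most `4 / m` per step, so some pair stays hidden for
`T` steps up to total variation `4 * T / m` (`exists_close_config_move`). With `m` linear in `N`,
every block can be connected unnoticed for linear time.

One block has size `p` with `p * q + r = OUT`. Further `K` blocks have sizes `L ^ i`, so far apart
that no number approximates two of the resulting outputs. If the algorithm usually stopped by time
`T` on the first instance, it would do so on all of them with nearly the same output distribution.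
The `K` success events are disjoint, so their probabilities would sum to about 1 at most, whereas
correctness requires `K * (1 - δ) > 2` (`card_mul_le_of_close`). Using many instances rather than
two covers all `δ < 1`. -/

namespace PMF

/-! ### Expectations and total variation distance -/

variable {X Y : Type}

/-- The expectation of an extended nonnegative function. -/
noncomputable def expect (p : PMF X) (f : X → ℝ≥0∞) : ℝ≥0∞ := ∑' x, p x * f x

theorem expect_mono (p : PMF X) {f g : X → ℝ≥0∞} (h : ∀ x, f x ≤ g x) :
    p.expect f ≤ p.expect g :=
  ENNReal.tsum_le_tsum fun x => mul_le_mul_right (h x) _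

theorem expect_add (p : PMF X) (f g : X → ℝ≥0∞) :
    p.expect (fun x => f x + g x) = p.expect f + p.expect g := by
  simp only [expect, mul_add, ENNReal.tsum_add]

theorem expect_sum {ι : Type} (p : PMF X) (s : Finset ι) (f : ι → X → ℝ≥0∞) :
    p.expect (fun x => ∑ i ∈ s, f i x) = ∑ i ∈ s, p.expect (f i) := by
  simp only [expect, Finset.mul_sum]
  exact Summable.tsum_finsetSum fun _ _ => ENNReal.summable

theorem expect_const (p : PMF X) (c : ℝ≥0∞) : p.expect (fun _ => c) = c := by
  simp [expect, ENNReal.tsum_mul_right, p.tsum_coe]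

theorem expect_pure (x : X) (f : X → ℝ≥0∞) : (PMF.pure x).expect f = f x := by
  classical
  rw [expect, tsum_eq_single x]
  · simp
  · intro y hy
    simp [PMF.pure_apply, hy]

theorem expect_bind (p : PMF X) (k : X → PMF Y) (f : Y → ℝ≥0∞) :
    (p.bind k).expect f = p.expect fun x => (k x).expect f := by
  simp only [expect, PMF.bind_apply, ← ENNReal.tsum_mul_right, ← ENNReal.tsum_mul_left]
  rw [ENNReal.tsum_comm]
  simp only [mul_assoc]

theorem expect_map (p : PMF X) (g : X → Y) (f : Y → ℝ≥0∞) :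
    (p.map g).expect f = p.expect fun x => f (g x) := by
  rw [PMF.map, expect_bind]
  simp only [Function.comp_apply, expect_pure]

theorem expect_uniformOfFinset (s : Finset X) (hs : s.Nonempty) (f : X → ℝ≥0∞) :
    (uniformOfFinset s hs).expect f = (∑ x ∈ s, f x) * (s.card : ℝ≥0∞)⁻¹ := by
  rw [expect, tsum_eq_sum (s := s), Finset.sum_mul]
  · refine Finset.sum_congr rfl fun x hx => ?_
    rw [uniformOfFinset_apply_of_mem hs hx, mul_comm]
  · intro x hx
    rw [uniformOfFinset_apply_of_notMem hs hx, zero_mul]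

theorem toOuterMeasure_eq_expect (p : PMF X) (S : Set X) :
    p.toOuterMeasure S = p.expect (S.indicator 1) := by
  classical
  rw [toOuterMeasure_apply, expect]
  refine tsum_congr fun x => ?_
  by_cases hx : x ∈ S <;> simp [hx]

/-- The total variation distance of `p` and `q` is at most `d`. -/
def Close (p q : PMF X) (d : ℝ≥0∞) : Prop :=
  ∀ f : X → ℝ≥0∞, (∀ x, f x ≤ 1) →
    p.expect f ≤ q.expect f + d ∧ q.expect f ≤ p.expect f + d

theorem Close.refl (p : PMF X) (d : ℝ≥0∞) : Close p p d :=
  fun _ _ => ⟨le_self_add, le_self_add⟩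

theorem Close.mono {p q : PMF X} {d d' : ℝ≥0∞} (h : Close p q d) (hd : d ≤ d') :
    Close p q d' := fun f hf =>
  ⟨(h f hf).1.trans (by gcongr), (h f hf).2.trans (by gcongr)⟩

theorem close_of_one_le (p q : PMF X) {d : ℝ≥0∞} (hd : 1 ≤ d) : Close p q d := by
  have key : ∀ (p q : PMF X) (f : X → ℝ≥0∞), (∀ x, f x ≤ 1) →
      p.expect f ≤ q.expect f + d := fun p q f hf =>
    ((p.expect_mono hf).trans_eq (p.expect_const 1)).trans (hd.trans le_add_self)
  exact fun f hf => ⟨key p q f hf, key q p f hf⟩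

theorem Close.map {p q : PMF X} {d : ℝ≥0∞} (h : Close p q d) (g : X → Y) :
    Close (p.map g) (q.map g) d := by
  intro f hf
  simp only [expect_map]
  exact h _ fun x => hf _

/-- The second-stage error is averaged under `q` alone. When `q` is the run on a fixed instance,
errors for different modifications are expectations over the same run and can be summed. -/
theorem Close.bind {p q : PMF X} {d : ℝ≥0∞} (h : Close p q d) {k l : X → PMF Y}
    {e : X → ℝ≥0∞} (hkl : ∀ x, Close (k x) (l x) (e x)) :
    Close (p.bind k) (q.bind l) (d + q.expect e) := by
  intro f hf
  have hk : ∀ x, (k x).expect f ≤ 1 := fun x =>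
    ((k x).expect_mono hf).trans_eq ((k x).expect_const 1)
  have h1 := h _ hk
  simp only [expect_bind]
  constructor
  · calc p.expect (fun x => (k x).expect f)
        ≤ q.expect (fun x => (k x).expect f) + d := h1.1
      _ ≤ q.expect (fun x => (l x).expect f + e x) + d := by
          gcongr
          exact q.expect_mono fun x => (hkl x f hf).1
      _ = _ := by rw [expect_add, add_assoc, add_comm d]
  · calc q.expect (fun x => (l x).expect f)
        ≤ q.expect (fun x => (k x).expect f + e x) := q.expect_mono fun x => (hkl x f hf).2
      _ = q.expect (fun x => (k x).expect f) + q.expect e := expect_add _ _ _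
      _ ≤ p.expect (fun x => (k x).expect f) + d + q.expect e := by
          gcongr
          exact h1.2
      _ = _ := by rw [add_assoc]

theorem Close.toOuterMeasure_le {p q : PMF X} {d : ℝ≥0∞} (h : Close p q d) (S : Set X) :
    p.toOuterMeasure S ≤ q.toOuterMeasure S + d ∧
      q.toOuterMeasure S ≤ p.toOuterMeasure S + d := by
  simp only [toOuterMeasure_eq_expect]
  exact h _ fun x => Set.indicator_le_self' (fun _ _ => zero_le_one) x

end PMF

/-! ### Exchanging two tuples of a stored relation -/

theorem agrees_none_congr {α β : Type} {u : Option α} {t t' : α × β} (h : t.1 = t'.1) :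
    Agrees u none t ↔ Agrees u none t' := by
  simp [Agrees, h]

namespace StoredRelation

variable {α β : Type}

theorem length_list (R : StoredRelation α β) (u : Option α) (v : Option β)
    [DecidablePred fun t : α × β => Agrees u v t] :
    (R.list u v).length = (R.tuples.filter fun t => Agrees u v t).card := by
  classical
  rw [← List.toFinset_card_of_nodup (R.nodup_list u v)]
  congr 1
  ext t
  simp [R.mem_list]

open Classical in
theorem swap_fst (a : α) (x y : β) (t : α × β) : (Equiv.swap (a, x) (a, y) t).1 = t.1 := by
  rw [Equiv.swap_apply_def]
  split_ifs with h1 h2 <;> simp_all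

open Classical in
/-- The relation with the tuples `(a, x)` and `(a, y)` exchanged. The stored orderings of the
matches of a partial tuple that specifies neither `x` nor `y` stay the same up to the exchange. -/
noncomputable def move (R : StoredRelation α β) (a : α) (x y : β) : StoredRelation α β where
  tuples := R.tuples.map (Equiv.swap (a, x) (a, y)).toEmbedding
  list u v := match v with
    | none => (R.list u none).map (Equiv.swap (a, x) (a, y))
    | some c =>
      -- Queries naming `x` or `y` are charged as distinguishing anyway, so any ordering serves
      -- here.
      if c = x ∨ c = y then
        ((R.tuples.map (Equiv.swap (a, x) (a, y)).toEmbedding).filter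
          fun t => Agrees u (some c) t).toList
      else R.list u (some c)
  nodup_list u v := by
    rcases v with _ | c
    · exact (R.nodup_list u none).map (Equiv.injective _)
    · dsimp only
      split_ifs
      · exact Finset.nodup_toList _
      · exact R.nodup_list _ _
  mem_list u v t := by
    rcases v with _ | c
    · simp only [List.mem_map, Finset.mem_map_equiv, Equiv.symm_swap]
      constructor
      · rintro ⟨s, hs, rfl⟩
        rw [R.mem_list] at hs
        exact ⟨by simpa using hs.1, (agrees_none_congr (swap_fst a x y s)).2 hs.2⟩
      · rintro ⟨h1, h2⟩
        exact ⟨_, (R.mem_list _ _ _).2 ⟨h1, (agrees_none_congr (swap_fst a x y t)).2 h2⟩,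
          by simp⟩
    · dsimp only
      split_ifs with hc
      · simp
      · rw [R.mem_list]
        refine and_congr_left fun h => ?_
        have h2 : t.2 = c := h.2 c rfl
        have hne : Equiv.swap (a, x) (a, y) t = t := by
          refine Equiv.swap_apply_of_ne_of_ne ?_ ?_ <;> rintro rfl <;> simp_all
        rw [Finset.mem_map_equiv, Equiv.symm_swap, hne]

theorem card_move (R : StoredRelation α β) (a : α) (x y : β) :
    (R.move a x y).tuples.card = R.tuples.card := Finset.card_map _

theorem mem_move (R : StoredRelation α β) {a : α} {x y : β} (hx : (a, x) ∈ R.tuples)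
    (hy : (a, y) ∉ R.tuples) (t : α × β) :
    t ∈ (R.move a x y).tuples ↔ t = (a, y) ∨ (t ∈ R.tuples ∧ t ≠ (a, x)) := by
  classical
  simp only [move, Finset.mem_map_equiv, Equiv.symm_swap, Equiv.swap_apply_def]
  split_ifs with h1 h2
  · subst h1
    have : x ≠ y := by rintro rfl; exact hy hx
    simp [hy, this]
  · subst h2
    simp [hx]
  · simp [h1, h2]

/-- The element of the second attribute revealed by a primitive other than sampling. -/
def touched (R : StoredRelation α β) : Primitive α β → Option β
  | .sample => none
  | .degree _ v => v
  | .neighbor _ (some c) _ => some c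
  | .neighbor u none j => ((R.list u none)[j]?).map Prod.snd
  | .test t => some t.2

/-- The chance that sampling returns one of two given tuples, and `0` for other primitives. -/
noncomputable def sampleCost (R : StoredRelation α β) : Primitive α β → ℝ≥0∞
  | .sample => 2 * (R.tuples.card : ℝ≥0∞)⁻¹
  | _ => 0

open Classical in
/-- A bound on the probability that a primitive distinguishes `R` from `R.move a x y`. -/
noncomputable def moveCost (R : StoredRelation α β) (q : Primitive α β) (x y : β) : ℝ≥0∞ :=
  R.sampleCost q + ((if R.touched q = some x then 1 else 0) +
    if R.touched q = some y then 1 else 0)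

/-- The exchange fixes first coordinates, so with the second attribute unspecified degrees survive
and position `j` changes only if it holds an exchanged tuple. With the second attribute specified
outside `x`, `y`, the stored list is kept verbatim. -/
theorem answer_move_of_not_touched (R : StoredRelation α β) (a : α) {x y : β}
    (q : Primitive α β) (hq : q ≠ .sample) (hx : R.touched q ≠ some x)
    (hy : R.touched q ≠ some y) : (R.move a x y).answer q = R.answer q := by
  classical
  have hlist : ∀ u c, c ≠ x → c ≠ y → (R.move a x y).list u (some c) = R.list u (some c) := by
    intro u c h1 h2
    simp [move, h1, h2]
  rcases q with _ | ⟨u, v⟩ | ⟨u, v, j⟩ | t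
  · exact absurd rfl hq
  · simp only [answer, ← length_list]
    rcases v with _ | c
    · simp [move]
    · rw [hlist u c (fun h => hx (by simp [touched, h])) fun h => hy (by simp [touched, h])]
  · simp only [answer]
    rcases v with _ | c
    · have : (R.move a x y).list u none = (R.list u none).map (Equiv.swap (a, x) (a, y)) := rfl
      rw [this, List.getElem?_map]
      simp only [touched] at hx hy
      rcases h : (R.list u none)[j]? with _ | t
      · rfl
      · rw [h] at hx hy
        have : Equiv.swap (a, x) (a, y) t = t := by
          refine Equiv.swap_apply_of_ne_of_ne ?_ ?_ <;> rintro rfl <;> simp_all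
        rw [Option.map_some, this]
    · rw [hlist u c (fun h => hx (by simp [touched, h])) fun h => hy (by simp [touched, h])]
  · simp only [answer]
    have : Equiv.swap (a, x) (a, y) t = t := by
      refine Equiv.swap_apply_of_ne_of_ne ?_ ?_ <;> rintro rfl <;> simp_all [touched]
    simp [move, Finset.mem_map_equiv, this]

theorem sum_swap_le (s : Finset (α × β)) [DecidableEq (α × β)] (t t' : α × β)
    (f g : α × β → ℝ≥0∞) (hf : ∀ z, f z ≤ 1) (hfg : ∀ z, z ≠ t → z ≠ t' → f z = g z) :
    ∑ z ∈ s, f z ≤ ∑ z ∈ s, g z + 2 := by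
  have h1 : ∀ w : α × β, ∑ z ∈ s, (if z = w then (1 : ℝ≥0∞) else 0) ≤ 1 := by
    intro w
    rw [Finset.sum_ite_eq' s w]
    split_ifs <;> simp
  calc ∑ z ∈ s, f z
      ≤ ∑ z ∈ s, (g z + ((if z = t then 1 else 0) + if z = t' then 1 else 0)) := by
        refine Finset.sum_le_sum fun z _ => ?_
        by_cases h1 : z = t
        · simp only [h1, if_true]
          exact (hf t).trans (le_self_add.trans le_add_self)
        · by_cases h2 : z = t'
          · simp only [h2, if_true]
            exact (hf t').trans (le_add_self.trans le_add_self)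
          · simp [h1, h2, hfg z h1 h2]
    _ ≤ ∑ z ∈ s, g z + (1 + 1) := by
        rw [Finset.sum_add_distrib, Finset.sum_add_distrib]
        gcongr <;> exact h1 _
    _ = _ := by norm_num

theorem close_answer_move (R : StoredRelation α β) (a : α) (x y : β) (q : Primitive α β) :
    PMF.Close ((R.move a x y).answer q) (R.answer q) (R.moveCost q x y) := by
  classical
  by_cases hq : q = .sample
  · subst hq
    by_cases hR : R.tuples.Nonempty
    · have hM : (R.move a x y).tuples.Nonempty := by simpa [move] using hR
      simp only [answer, hR, hM, dif_pos]
      refine PMF.Close.map (d := R.moveCost .sample x y) ?_ some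
      intro f hf
      have hfix : ∀ z, z ≠ (a, x) → z ≠ (a, y) → f (Equiv.swap (a, x) (a, y) z) = f z :=
        fun z h1 h2 => by rw [Equiv.swap_apply_of_ne_of_ne h1 h2]
      have hc : R.moveCost .sample x y = 2 * (R.tuples.card : ℝ≥0∞)⁻¹ := by
        simp [moveCost, sampleCost, touched]
      have hs : ∑ z ∈ (R.move a x y).tuples, f z
          = ∑ z ∈ R.tuples, f (Equiv.swap (a, x) (a, y) z) := by
        simp [move]
      rw [PMF.expect_uniformOfFinset, PMF.expect_uniformOfFinset, hc, card_move, hs, ← add_mul,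
        ← add_mul]
      constructor
      · gcongr
        exact sum_swap_le _ (a, x) (a, y) _ _ (fun z => hf _) hfix
      · gcongr
        exact sum_swap_le _ (a, x) (a, y) _ _ hf fun z h1 h2 => (hfix z h1 h2).symm
    · have hM : ¬ (R.move a x y).tuples.Nonempty := by simpa [move] using hR
      simp only [answer, hR, hM, dif_neg, not_false_eq_true]
      exact PMF.Close.refl _ _
  · by_cases hx : R.touched q = some x
    · refine PMF.close_of_one_le _ _ ?_
      rw [moveCost, if_pos hx]
      exact le_self_add.trans le_add_self
    · by_cases hy : R.touched q = some y
      · refine PMF.close_of_one_le _ _ ?_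
        rw [moveCost, if_pos hy]
        exact le_add_self.trans le_add_self
      · rw [answer_move_of_not_touched R a q hq hx hy]
        exact PMF.Close.refl _ _

/-- Sampling costs at most `2 / m` for each of the `m ^ 2` pairs. Any other primitive touches at
most one element, which occurs in at most `m` pairs as first entry and in at most `m` as second. -/
theorem sum_moveCost_le (R : StoredRelation α β) (q : Primitive α β) (X Y : Finset β) {m : ℕ}
    (hX : X.card = m) (hY : Y.card = m) (hR : m ≤ R.tuples.card) :
    ∑ z ∈ X ×ˢ Y, R.moveCost q z.1 z.2 ≤ 4 * m := by
  classical
  have h1 : ∀ (S : Finset β) (o : Option β),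
      ∑ z ∈ S, (if o = some z then (1 : ℝ≥0∞) else 0) ≤ 1 := by
    intro S o
    rcases o with _ | c
    · simp
    · simp only [Option.some_inj]
      rw [Finset.sum_ite_eq S c]
      split_ifs <;> simp
  have hs : R.sampleCost q ≤ 2 * (m : ℝ≥0∞)⁻¹ := by
    cases q <;> simp only [sampleCost, zero_le]
    gcongr
  simp only [moveCost, Finset.sum_add_distrib, Finset.sum_const, Finset.card_product]
  simp only [Finset.sum_product]
  rw [Finset.sum_comm (s := X) (t := Y) (f := fun x _ => ite (R.touched q = some x) _ _),
    hX, hY]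
  simp only [nsmul_eq_mul, Nat.cast_mul]
  have h2 : (m : ℝ≥0∞) * m * R.sampleCost q ≤ 2 * m := by
    rcases Nat.eq_zero_or_pos m with rfl | hm
    · simp
    · calc (m : ℝ≥0∞) * m * R.sampleCost q ≤ m * m * (2 * (m : ℝ≥0∞)⁻¹) := by gcongr
        _ = 2 * m * (m * (m : ℝ≥0∞)⁻¹) := by ring
        _ = 2 * m := by
          rw [ENNReal.mul_inv_cancel (by exact_mod_cast hm.ne') (by simp), mul_one]
  have h3 : ∑ _y ∈ Y, ∑ x ∈ X, (if R.touched q = some x then (1 : ℝ≥0∞) else 0) ≤ m := by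
    refine (Finset.sum_le_card_nsmul Y _ 1 fun _ _ => h1 X _).trans ?_
    simp [hY]
  have h4 : ∑ _x ∈ X, ∑ y ∈ Y, (if R.touched q = some y then (1 : ℝ≥0∞) else 0) ≤ m := by
    refine (Finset.sum_le_card_nsmul X _ 1 fun _ _ => h1 Y _).trans ?_
    simp [hX]
  calc _ ≤ 2 * (m : ℝ≥0∞) + (m + m) := add_le_add h2 (add_le_add h3 h4)
    _ = 4 * m := by ring

end StoredRelation

/-! ### Indistinguishability of runs -/

namespace ChainInstance

variable {A B C D E : Type}

/-- The instance with `(b, x)` and `(b, y)` exchanged in the second relation. -/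
noncomputable def move (I : ChainInstance A B C D E) (b : B) (x y : C) :
    ChainInstance A B C D E :=
  { I with R₂ := I.R₂.move b x y }

/-- A bound on the probability that a call distinguishes `I` from `I.move b x y`. -/
noncomputable def moveCost (I : ChainInstance A B C D E) :
    ChainPrimitive A B C D E → C → C → ℝ≥0∞
  | .onR₂ q, x, y => I.R₂.moveCost q x y
  | _, _, _ => 0

theorem close_answer_move (I : ChainInstance A B C D E) (b : B) (x y : C)
    (q : ChainPrimitive A B C D E) :
    PMF.Close ((I.move b x y).answer q) (I.answer q) (I.moveCost q x y) := by
  rcases q with q | q | q | q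
  · exact PMF.Close.refl (I.R₁.answer q) _
  · exact I.R₂.close_answer_move b x y q
  · exact PMF.Close.refl (I.R₃.answer q) _
  · exact PMF.Close.refl (I.R₄.answer q) _

end ChainInstance

namespace ChainAlgorithm

variable {A B C D E : Type}

/-- A bound on the probability that one step distinguishes `I` from `I.move b x y`. -/
noncomputable def moveCost (𝒜 : ChainAlgorithm A B C D E) (I : ChainInstance A B C D E)
    (s : 𝒜.State ⊕ ℝ) (x y : C) : ℝ≥0∞ :=
  match s with
  | .inr _ => 0
  | .inl s =>
    match 𝒜.next s with
    | .call q _ => I.moveCost q x y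
    | _ => 0

theorem close_step_move (𝒜 : ChainAlgorithm A B C D E) (I : ChainInstance A B C D E) (b : B)
    (x y : C) (s : 𝒜.State ⊕ ℝ) :
    PMF.Close (𝒜.step (I.move b x y) s) (𝒜.step I s) (𝒜.moveCost I s x y) := by
  rcases s with s | v
  · rcases h : 𝒜.next s with v | s' | ⟨a, b', hab, k⟩ | ⟨q, k⟩
    · simp only [step, h]
      exact PMF.Close.refl _ _
    · simp only [step, h]
      exact PMF.Close.refl _ _
    · simp only [step, h]
      exact PMF.Close.refl _ _
    · simp only [step, moveCost, h]
      exact (I.close_answer_move b x y q).map _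
  · exact PMF.Close.refl _ _

theorem sum_moveCost_le (𝒜 : ChainAlgorithm A B C D E) (I : ChainInstance A B C D E)
    (s : 𝒜.State ⊕ ℝ) (X Y : Finset C) {m : ℕ} (hX : X.card = m) (hY : Y.card = m)
    (hR : m ≤ I.R₂.tuples.card) :
    ∑ z ∈ X ×ˢ Y, 𝒜.moveCost I s z.1 z.2 ≤ 4 * m := by
  rcases s with s | v
  · rcases h : 𝒜.next s with v | s' | ⟨a, b', hab, k⟩ | ⟨q, k⟩
    · simp [moveCost, h]
    · simp [moveCost, h]
    · simp [moveCost, h]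
    · simp only [moveCost, h]
      rcases q with q | q | q | q
      · simp [ChainInstance.moveCost]
      · exact I.R₂.sum_moveCost_le q X Y hX hY hR
      · simp [ChainInstance.moveCost]
      · simp [ChainInstance.moveCost]
  · simp [moveCost]

/-- A hybrid argument: the per-step costs add up along the run on `I`, whose law does not depend on
`x` and `y`. -/
theorem close_config_move (𝒜 : ChainAlgorithm A B C D E) (I : ChainInstance A B C D E) (b : B)
    (x y : C) (T : ℕ) :
    PMF.Close (𝒜.config (I.move b x y) T) (𝒜.config I T)
      (∑ n ∈ Finset.range T, (𝒜.config I n).expect fun s => 𝒜.moveCost I s x y) := by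
  induction T with
  | zero => exact PMF.Close.refl _ _
  | succ T ih =>
    rw [Finset.sum_range_succ]
    exact ih.bind fun s => 𝒜.close_step_move I b x y s

/-- Averaging: the total cost over `T` steps and all `m ^ 2` pairs is at most `4 * m * T`, so some
pair costs at most the mean. -/
theorem exists_close_config_move (𝒜 : ChainAlgorithm A B C D E) (I : ChainInstance A B C D E)
    (b : B) (X Y : Finset C) {m : ℕ} (hm : 0 < m) (hX : X.card = m) (hY : Y.card = m)
    (hR : m ≤ I.R₂.tuples.card) (T : ℕ) :
    ∃ x ∈ X, ∃ y ∈ Y, PMF.Close (𝒜.config (I.move b x y) T) (𝒜.config I T)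
      (4 * T / m) := by
  have hm0 : (m : ℝ≥0∞) ≠ 0 := by exact_mod_cast hm.ne'
  have hne : (X ×ˢ Y).Nonempty := by
    rw [← Finset.card_pos, Finset.card_product, hX, hY]
    positivity
  have hsum : ∑ z ∈ X ×ˢ Y, ∑ n ∈ Finset.range T,
      (𝒜.config I n).expect (fun s => 𝒜.moveCost I s z.1 z.2)
      ≤ ∑ _z ∈ X ×ˢ Y, (4 * T / m : ℝ≥0∞) := by
    rw [Finset.sum_comm]
    calc _ ≤ ∑ _n ∈ Finset.range T, (4 * m : ℝ≥0∞) := by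
          refine Finset.sum_le_sum fun n _ => ?_
          rw [← PMF.expect_sum]
          exact (PMF.expect_mono _ fun s => 𝒜.sum_moveCost_le I s X Y hX hY hR).trans_eq
            (PMF.expect_const _ _)
      _ = 4 * T * m := by
          rw [Finset.sum_const, Finset.card_range, nsmul_eq_mul]
          ring
      _ = 4 * T * m * (m * (m : ℝ≥0∞)⁻¹) := by
          rw [ENNReal.mul_inv_cancel hm0 (by simp), mul_one]
      _ = _ := by
          rw [Finset.sum_const, Finset.card_product, hX, hY, nsmul_eq_mul, div_eq_mul_inv]
          push_cast
          ring
  obtain ⟨z, hz, h⟩ := ENNReal.exists_le_of_sum_le hne hsum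
  rw [Finset.mem_product] at hz
  exact ⟨z.1, hz.1, z.2, hz.2, (𝒜.close_config_move I b z.1 z.2 T).mono h⟩

end ChainAlgorithm

/-! ### The hard instances -/

open Classical in
/-- A finite relation, stored with arbitrary orderings. -/
noncomputable def StoredRelation.ofFinset {α β : Type} (s : Finset (α × β)) :
    StoredRelation α β where
  tuples := s
  list x y := (s.filter fun t => Agrees x y t).toList
  nodup_list _ _ := Finset.nodup_toList _
  mem_list x y t := by simp

namespace ChainInstance

section Blocks

variable {A B C D E ι : Type} {w : ι → ℕ} {m r t : ℕ}

/-- The tuples of the first relation: block `i` consists of `w i` elements attached to the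
`i`-th junction, and there is one more element attached to the junction `none`. -/
def blockTuple₁ (fA : Option (Σ i, Fin (w i)) ↪ A) (fB : Option ι ↪ B)
    (s : Option (Σ i, Fin (w i))) : A × B :=
  (fA s, fB (s.map Sigma.fst))

/-- The tuples of the second relation: each junction has `m` successors of its own, the junction
`none` has just one. -/
def blockTuple₂ (fB : Option ι ↪ B) (fC : Option (Option ι × Fin m) ↪ C) :
    Option (ι × Fin m) → B × C
  | some (i, k) => (fB (some i), fC (some (some i, k)))
  | none => (fB none, fC none)

/-- The tuples of the third relation: `m` elements are attached to both elements of `D`, and the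
successor of the junction `none` is attached to one of these. -/
def blockTuple₃ (fC : Option (Option ι × Fin m) ↪ C) (fD : Bool ↪ D) :
    Option (Fin m × Bool) → C × D
  | some (k, s) => (fC (some (none, k)), fD s)
  | none => (fC none, fD false)

/-- The tuples of the fourth relation. -/
def blockTuple₄ (fD : Bool ↪ D) (fE : Fin r ⊕ Fin t ↪ E) (u : Fin r ⊕ Fin t) : D × E :=
  (fD u.isRight, fE u)

theorem blockTuple₁_injective (fA : Option (Σ i, Fin (w i)) ↪ A) (fB : Option ι ↪ B) :
    Function.Injective (blockTuple₁ fA fB) := by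
  intro s s' h
  simp only [blockTuple₁, Prod.mk.injEq, EmbeddingLike.apply_eq_iff_eq] at h
  exact h.1

theorem blockTuple₂_injective (fB : Option ι ↪ B) (fC : Option (Option ι × Fin m) ↪ C) :
    Function.Injective (blockTuple₂ fB fC) := by
  rintro (_ | ⟨i, k⟩) (_ | ⟨j, l⟩) h <;> simp_all [blockTuple₂]

theorem blockTuple₃_injective (fC : Option (Option ι × Fin m) ↪ C) (fD : Bool ↪ D) :
    Function.Injective (blockTuple₃ fC fD) := by
  rintro (_ | ⟨i, k⟩) (_ | ⟨j, l⟩) h <;> simp_all [blockTuple₃]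

theorem blockTuple₄_injective (fD : Bool ↪ D) (fE : Fin r ⊕ Fin t ↪ E) :
    Function.Injective (blockTuple₄ fD fE) := by
  intro s s' h
  simp only [blockTuple₄, Prod.mk.injEq, EmbeddingLike.apply_eq_iff_eq] at h
  exact h.2

/-- The output tuples once block `i` is connected. -/
def blockOutput (fA : Option (Σ i, Fin (w i)) ↪ A) (fE : Fin r ⊕ Fin t ↪ E) (i : ι) :
    (Fin (w i) × (Fin r ⊕ Fin t)) ⊕ Fin r → A × E
  | .inl (k, e) => (fA (some ⟨i, k⟩), fE e)
  | .inr e => (fA none, fE (.inl e))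

theorem blockOutput_injective (fA : Option (Σ i, Fin (w i)) ↪ A) (fE : Fin r ⊕ Fin t ↪ E)
    (i : ι) : Function.Injective (blockOutput fA fE i) := by
  rintro (⟨k, e⟩ | e) (⟨k', e'⟩ | e') h <;> simp_all [blockOutput]

variable [Fintype ι]

open Classical in
/-- The instance in which no block is connected to the elements of `D`. -/
noncomputable def blocks (fA : Option (Σ i, Fin (w i)) ↪ A) (fB : Option ι ↪ B)
    (fC : Option (Option ι × Fin m) ↪ C) (fD : Bool ↪ D) (fE : Fin r ⊕ Fin t ↪ E) :
    ChainInstance A B C D E where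
  R₁ := .ofFinset (Finset.univ.image (blockTuple₁ fA fB))
  R₂ := .ofFinset (Finset.univ.image (blockTuple₂ fB fC))
  R₃ := .ofFinset (Finset.univ.image (blockTuple₃ fC fD))
  R₄ := .ofFinset (Finset.univ.image (blockTuple₄ fD fE))

variable (fA : Option (Σ i, Fin (w i)) ↪ A) (fB : Option ι ↪ B)
  (fC : Option (Option ι × Fin m) ↪ C) (fD : Bool ↪ D) (fE : Fin r ⊕ Fin t ↪ E)

theorem inputSize_blocks : (blocks fA fB fC fD fE).inputSize =
    (∑ i, w i + 1) + (Fintype.card ι * m + 1) + (m * 2 + 1) + (r + t) := by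
  classical
  simp only [inputSize, blocks, StoredRelation.ofFinset]
  rw [Finset.card_image_of_injective _ (blockTuple₁_injective fA fB),
    Finset.card_image_of_injective _ (blockTuple₂_injective fB fC),
    Finset.card_image_of_injective _ (blockTuple₃_injective fC fD),
    Finset.card_image_of_injective _ (blockTuple₄_injective fD fE)]
  simp

theorem le_card_R₂_blocks (i : ι) : m ≤ (blocks fA fB fC fD fE).R₂.tuples.card := by
  classical
  simp only [blocks, StoredRelation.ofFinset]
  rw [Finset.card_image_of_injective _ (blockTuple₂_injective fB fC)]
  have : 1 ≤ Fintype.card ι := Fintype.card_pos_iff.2 ⟨i⟩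
  simp only [Finset.card_univ, Fintype.card_option, Fintype.card_prod, Fintype.card_fin]
  nlinarith

theorem inputSize_move (I : ChainInstance A B C D E) (b : B) (x y : C) :
    (I.move b x y).inputSize = I.inputSize := by
  simp [inputSize, move, StoredRelation.card_move]

/-- Block `i` gets out only through the new tuple, whose endpoint reaches both elements of `D` and
hence all `r + t` endpoints. The junction `none` always contributes `r` more pairs. -/
theorem result_move_blocks (i : ι) (k l : Fin m) :
    ((blocks fA fB fC fD fE).move (fB (some i)) (fC (some (some i, k)))
      (fC (some (none, l)))).result = Set.range (blockOutput fA fE i) := by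
  classical
  have h2 : ∀ z, z ∈ ((blocks fA fB fC fD fE).move (fB (some i)) (fC (some (some i, k)))
      (fC (some (none, l)))).R₂.tuples ↔ z = (fB (some i), fC (some (none, l))) ∨
        (∃ o, blockTuple₂ fB fC o = z) ∧ z ≠ (fB (some i), fC (some (some i, k))) := by
    intro z
    have hx : (fB (some i), fC (some (some i, k))) ∈ (blocks fA fB fC fD fE).R₂.tuples :=
      Finset.mem_image.2 ⟨some (i, k), Finset.mem_univ _, rfl⟩
    have hy : (fB (some i), fC (some (none, l))) ∉ (blocks fA fB fC fD fE).R₂.tuples := by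
      intro h
      obtain ⟨(_ | ⟨j, k⟩), -, h⟩ := Finset.mem_image.1 h <;> simp [blockTuple₂] at h
    refine (StoredRelation.mem_move _ hx hy z).trans ?_
    simp [blocks, StoredRelation.ofFinset]
  ext ⟨a, e⟩
  constructor
  · rintro ⟨b, c, d, h1, hbc, h3, h4⟩
    obtain ⟨s, -, h1'⟩ := Finset.mem_image.1 h1
    obtain ⟨o, -, h3'⟩ := Finset.mem_image.1 h3
    obtain ⟨u, -, h4'⟩ := Finset.mem_image.1 h4
    clear h1 h3 h4
    simp only [blockTuple₁, blockTuple₄, Prod.mk.injEq] at h1' h4'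
    obtain ⟨rfl, rfl⟩ := h1'
    obtain ⟨rfl, rfl⟩ := h4'
    rcases (h2 _).1 hbc with h | ⟨⟨o', h⟩, -⟩
    · simp only [Prod.mk.injEq, EmbeddingLike.apply_eq_iff_eq, Option.map_eq_some_iff] at h
      obtain ⟨⟨⟨j, n⟩, rfl, rfl⟩, -⟩ := h
      exact ⟨.inl (n, u), rfl⟩
    · rcases o' with _ | ⟨j, n⟩
      · simp only [blockTuple₂, Prod.mk.injEq, EmbeddingLike.apply_eq_iff_eq] at h
        obtain ⟨h, rfl⟩ := h
        rcases s with _ | s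
        · rcases o with _ | ⟨n, v⟩
          · rcases u with u | u
            · exact ⟨.inr u, rfl⟩
            · simp [blockTuple₃] at h3'
          · simp [blockTuple₃] at h3'
        · simp at h
      -- Private successors do not occur in the third relation.
      · simp only [blockTuple₂, Prod.mk.injEq] at h
        rw [← h.2] at h3'
        rcases o with _ | ⟨n, v⟩ <;> simp [blockTuple₃] at h3'
  · have h1 : ∀ s, blockTuple₁ fA fB s ∈ ((blocks fA fB fC fD fE).move (fB (some i))
        (fC (some (some i, k))) (fC (some (none, l)))).R₁.tuples := fun s =>
      Finset.mem_image.2 ⟨s, Finset.mem_univ _, rfl⟩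
    have h3 : ∀ s, blockTuple₃ fC fD s ∈ ((blocks fA fB fC fD fE).move (fB (some i))
        (fC (some (some i, k))) (fC (some (none, l)))).R₃.tuples := fun s =>
      Finset.mem_image.2 ⟨s, Finset.mem_univ _, rfl⟩
    have h4 : ∀ s, blockTuple₄ fD fE s ∈ ((blocks fA fB fC fD fE).move (fB (some i))
        (fC (some (some i, k))) (fC (some (none, l)))).R₄.tuples := fun s =>
      Finset.mem_image.2 ⟨s, Finset.mem_univ _, rfl⟩
    rintro ⟨(⟨n, u⟩ | u), h⟩
    · simp only [blockOutput, Prod.mk.injEq] at h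
      obtain ⟨rfl, rfl⟩ := h
      exact ⟨_, _, _, h1 (some ⟨i, n⟩), (h2 _).2 (.inl rfl), h3 (some (l, u.isRight)), h4 u⟩
    · simp only [blockOutput, Prod.mk.injEq] at h
      obtain ⟨rfl, rfl⟩ := h
      exact ⟨_, _, _, h1 none, (h2 _).2 (.inr ⟨⟨none, rfl⟩, by simp⟩), h3 none, h4 (.inl u)⟩

theorem outputSize_move_blocks (i : ι) (k l : Fin m) :
    ((blocks fA fB fC fD fE).move (fB (some i)) (fC (some (some i, k)))
      (fC (some (none, l)))).outputSize = w i * (r + t) + r := by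
  rw [outputSize, result_move_blocks, ← Nat.card_coe_set_eq,
    Nat.card_range_of_injective (blockOutput_injective fA fE i), Nat.card_eq_fintype_card]
  simp

/-- For every time bound, each block can be connected without the algorithm noticing it. -/
theorem exists_close_config_blocks (𝒜 : ChainAlgorithm A B C D E) (hm : 0 < m) (i : ι) (T : ℕ) :
    ∃ I : ChainInstance A B C D E, I.inputSize = (blocks fA fB fC fD fE).inputSize ∧
      I.outputSize = w i * (r + t) + r ∧
      PMF.Close (𝒜.config I T) (𝒜.config (blocks fA fB fC fD fE) T) (4 * T / m) := by
  classical
  have hX : ∀ o : Option ι, (Finset.univ.image fun k : Fin m => fC (some (o, k))).card = m := by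
    intro o
    rw [Finset.card_image_of_injective]
    · simp
    · intro k l h
      simpa using h
  obtain ⟨x, hx, y, hy, h⟩ := 𝒜.exists_close_config_move (blocks fA fB fC fD fE) (fB (some i))
    _ _ hm (hX (some i)) (hX none) (le_card_R₂_blocks fA fB fC fD fE i) T
  obtain ⟨k, -, rfl⟩ := Finset.mem_image.1 hx
  obtain ⟨l, -, rfl⟩ := Finset.mem_image.1 hy
  exact ⟨_, inputSize_move _ _ _ _, outputSize_move_blocks fA fB fC fD fE i k l, h⟩

end Blocks

end ChainInstance

theorem nonempty_embedding_of_card_le {α β : Type} [Fintype α] {N : ℕ}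
    (hα : Fintype.card α ≤ N) (hβ : (N : ℕ∞) ≤ ENat.card β) : Nonempty (α ↪ β) := by
  rw [← Cardinal.le_def, Cardinal.mk_fintype]
  rw [ENat.card, Cardinal.natCast_le_toENat] at hβ
  exact le_trans (by exact_mod_cast hα) hβ

/-- Instances of the same input size `N`, one of them for each `i`, that no algorithm can tell
from a common one in few steps although their output sizes differ. -/
theorem ChainAlgorithm.exists_close_instances {A B C D E ι : Type} [Fintype ι] {N : ℕ}
    (hA : (N : ℕ∞) ≤ ENat.card A) (hB : (N : ℕ∞) ≤ ENat.card B)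
    (hC : (N : ℕ∞) ≤ ENat.card C) (hD : (N : ℕ∞) ≤ ENat.card D)
    (hE : (N : ℕ∞) ≤ ENat.card E) (w : ι → ℕ) {m r q : ℕ} (hm : 0 < m) (hr : r ≤ q)
    (hN : ∑ i, w i + (Fintype.card ι + 2) * m + q + 3 = N) (𝒜 : ChainAlgorithm A B C D E)
    (T : ℕ) :
    ∃ J : ChainInstance A B C D E, ∀ i, ∃ I : ChainInstance A B C D E, I.inputSize = N ∧
      I.outputSize = w i * q + r ∧ PMF.Close (𝒜.config I T) (𝒜.config J T) (4 * T / m) := by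
  have hι : Fintype.card ι ≤ Fintype.card ι * m := Nat.le_mul_of_pos_right _ hm
  have hN' := hN
  rw [add_mul] at hN'
  -- The `q` endpoints split into `r` below `false`, seen by the junction `none`, and `t` below
  -- `true`.
  obtain ⟨t, rfl⟩ := Nat.exists_eq_add_of_le hr
  obtain ⟨fA⟩ := nonempty_embedding_of_card_le (α := Option (Σ i, Fin (w i))) (β := A) (N := N)
    (by simp; lia) hA
  obtain ⟨fB⟩ := nonempty_embedding_of_card_le (α := Option ι) (β := B) (N := N)
    (by simp; lia) hB
  obtain ⟨fC⟩ := nonempty_embedding_of_card_le (α := Option (Option ι × Fin m)) (β := C) (N := N)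
    (by simp [add_mul]; lia) hC
  obtain ⟨fD⟩ := nonempty_embedding_of_card_le (α := Bool) (β := D) (N := N)
    (by simp; lia) hD
  obtain ⟨fE⟩ := nonempty_embedding_of_card_le (α := Fin r ⊕ Fin t) (β := E) (N := N)
    (by simp; lia) hE
  refine ⟨ChainInstance.blocks fA fB fC fD fE, fun i => ?_⟩
  obtain ⟨I, h1, h2, h3⟩ := ChainInstance.exists_close_config_blocks fA fB fC fD fE 𝒜 hm i T
  refine ⟨I, ?_, h2, h3⟩
  rw [h1, ChainInstance.inputSize_blocks, ← hN]
  ring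

theorem PMF.sum_toOuterMeasure_le_one {X ι : Type} [Fintype ι] (p : PMF X) {S : ι → Set X}
    (hS : ∀ i j x, x ∈ S i → x ∈ S j → i = j) : ∑ i, p.toOuterMeasure (S i) ≤ 1 := by
  classical
  simp only [toOuterMeasure_eq_expect]
  rw [← expect_sum]
  refine (p.expect_mono (g := fun _ => 1) fun x => ?_).trans_eq (p.expect_const 1)
  by_cases h : ∃ i, x ∈ S i
  · obtain ⟨i, hi⟩ := h
    rw [Finset.sum_eq_single i]
    · exact Set.indicator_le_self' (fun _ _ => zero_le_one) x
    · exact fun j _ hj => Set.indicator_of_notMem (fun h => hj (hS j i x h hi)) _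
    · simp
  · rw [Finset.sum_eq_zero]
    · exact zero_le_one
    · exact fun i _ => Set.indicator_of_notMem (fun hi => h ⟨i, hi⟩) _

/-! ### Stopping probabilities and running time -/

namespace ChainAlgorithm

variable {A B C D E : Type} (𝒜 : ChainAlgorithm A B C D E) (I : ChainInstance A B C D E)

theorem toOuterMeasure_config_succ (n : ℕ) (F : Set (𝒜.State ⊕ ℝ)) :
    (𝒜.config I (n + 1)).toOuterMeasure F =
      (𝒜.config I n).expect fun s => (𝒜.step I s).toOuterMeasure F := by
  simp only [PMF.toOuterMeasure_eq_expect, config, PMF.expect_bind]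

/-- The probability of having stopped with an output in `S` does not decrease. -/
theorem monotone_stopped (S : Set ℝ) :
    Monotone fun n => (𝒜.config I n).toOuterMeasure (Sum.inr '' S) := by
  refine monotone_nat_of_le_succ fun n => ?_
  rw [toOuterMeasure_config_succ, PMF.toOuterMeasure_eq_expect]
  refine PMF.expect_mono _ fun s => ?_
  by_cases hs : s ∈ Sum.inr '' S
  · obtain ⟨v, hv, rfl⟩ := hs
    simp only [step]
    rw [PMF.toOuterMeasure_eq_expect, PMF.expect_pure]
  · rw [Set.indicator_of_notMem hs]
    exact zero_le

/-- The probability of not having stopped with an output outside `S` does not increase. -/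
theorem antitone_stopped_or_running (S : Set ℝ) :
    Antitone fun n => (𝒜.config I n).toOuterMeasure (Sum.inr '' S ∪ Set.range Sum.inl) := by
  classical
  refine antitone_nat_of_succ_le fun n => ?_
  rw [toOuterMeasure_config_succ, PMF.toOuterMeasure_eq_expect]
  refine PMF.expect_mono _ fun s => ?_
  by_cases hs : s ∈ Sum.inr '' S ∪ Set.range Sum.inl
  · rw [Set.indicator_of_mem hs, PMF.toOuterMeasure_eq_expect]
    exact (PMF.expect_mono _ fun x =>
      Set.indicator_le_self' (fun _ _ => zero_le_one) x).trans_eq (PMF.expect_const _ 1)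
  · rcases s with s | v
    · exact absurd (Or.inr ⟨s, rfl⟩) hs
    · simp only [step]
      rw [PMF.toOuterMeasure_eq_expect, PMF.expect_pure]

theorem antitone_running :
    Antitone fun n => (𝒜.config I n).toOuterMeasure (Set.range Sum.inl) := by
  simpa using 𝒜.antitone_stopped_or_running I ∅

/-- A run that eventually succeeds has at time `T` either succeeded already or not yet stopped. -/
theorem outputProb_le (S : Set ℝ) (T : ℕ) :
    𝒜.outputProb I S ≤ (𝒜.config I T).toOuterMeasure (Sum.inr '' S ∪ Set.range Sum.inl) := by
  refine iSup_le fun n => ?_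
  calc (𝒜.config I n).toOuterMeasure (Sum.inr '' S)
      ≤ (𝒜.config I (max n T)).toOuterMeasure (Sum.inr '' S) :=
        𝒜.monotone_stopped I S (le_max_left _ _)
    _ ≤ (𝒜.config I (max n T)).toOuterMeasure (Sum.inr '' S ∪ Set.range Sum.inl) :=
        MeasureTheory.measure_mono Set.subset_union_left
    _ ≤ _ := 𝒜.antitone_stopped_or_running I S (le_max_right _ _)

/-- Markov's inequality for the running time. -/
theorem mul_running_le_expectedTime (T : ℕ) :
    T * (𝒜.config I T).toOuterMeasure (Set.range Sum.inl) ≤ 𝒜.expectedTime I := by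
  calc (T : ℝ≥0∞) * (𝒜.config I T).toOuterMeasure (Set.range Sum.inl)
      = ∑ _n ∈ Finset.range T, (𝒜.config I T).toOuterMeasure (Set.range Sum.inl) := by simp
    _ ≤ ∑ n ∈ Finset.range T, (𝒜.config I n).toOuterMeasure (Set.range Sum.inl) :=
        Finset.sum_le_sum fun n hn => 𝒜.antitone_running I (Finset.mem_range.1 hn).le
    _ ≤ _ := ENNReal.sum_le_tsum _

variable {I}

theorem outputProb_le_of_close {I₀ J : ChainInstance A B C D E} {T : ℕ} {d : ℝ≥0∞}
    (h₀ : PMF.Close (𝒜.config I₀ T) (𝒜.config J T) d)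
    (h : PMF.Close (𝒜.config I T) (𝒜.config J T) d) (S : Set ℝ) :
    𝒜.outputProb I S ≤ (𝒜.config J T).toOuterMeasure (Sum.inr '' S) +
      ((𝒜.config I₀ T).toOuterMeasure (Set.range Sum.inl) + d + d) := by
  calc 𝒜.outputProb I S
      ≤ (𝒜.config I T).toOuterMeasure (Sum.inr '' S ∪ Set.range Sum.inl) :=
        𝒜.outputProb_le I S T
    _ ≤ (𝒜.config J T).toOuterMeasure (Sum.inr '' S ∪ Set.range Sum.inl) + d :=
        (h.toOuterMeasure_le _).1
    _ ≤ (𝒜.config J T).toOuterMeasure (Sum.inr '' S) +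
          (𝒜.config J T).toOuterMeasure (Set.range Sum.inl) + d := by
        gcongr
        exact MeasureTheory.measure_union_le _ _
    -- Only the running probability is moved to `I₀`, where the time is measured; this costs the
    -- second `d`.
    _ ≤ (𝒜.config J T).toOuterMeasure (Sum.inr '' S) +
          ((𝒜.config I₀ T).toOuterMeasure (Set.range Sum.inl) + d) + d := by
        gcongr
        exact (h₀.toOuterMeasure_le _).2
    _ = _ := by rw [add_assoc]

/-- If the runs on `I₀` and on each `I i` are close to a common one, where the outputs required
on the instances `I i` exclude each other, then the algorithm often runs for more than `T` steps
on `I₀`. -/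
theorem card_mul_le_of_close {ι : Type} [Fintype ι] {I₀ J : ChainInstance A B C D E}
    {I : ι → ChainInstance A B C D E} {T : ℕ} {d ρ : ℝ≥0∞}
    (h₀ : PMF.Close (𝒜.config I₀ T) (𝒜.config J T) d)
    (h : ∀ i, PMF.Close (𝒜.config (I i) T) (𝒜.config J T) d) {S : ι → Set ℝ}
    (hS : ∀ i j v, v ∈ S i → v ∈ S j → i = j) (hρ : ∀ i, ρ ≤ 𝒜.outputProb (I i) (S i)) :
    Fintype.card ι * ρ ≤ 1 + Fintype.card ι *
      ((𝒜.config I₀ T).toOuterMeasure (Set.range Sum.inl) + d + d) := by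
  calc Fintype.card ι * ρ = ∑ _i : ι, ρ := by simp
    _ ≤ ∑ i, ((𝒜.config J T).toOuterMeasure (Sum.inr '' S i) +
          ((𝒜.config I₀ T).toOuterMeasure (Set.range Sum.inl) + d + d)) :=
        Finset.sum_le_sum fun i _ =>
          (hρ i).trans (𝒜.outputProb_le_of_close h₀ (h i) (S i))
    _ ≤ _ := by
        rw [Finset.sum_add_distrib, Finset.sum_const, Finset.card_univ, nsmul_eq_mul]
        gcongr
        refine PMF.sum_toOuterMeasure_le_one _ fun i j x hi hj => ?_
        obtain ⟨v, hv, rfl⟩ := hi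
        obtain ⟨v', hv', hvv⟩ := hj
        obtain rfl := Sum.inr_injective hvv
        exact hS i j _ hv hv'

end ChainAlgorithm

/-! ### Choice of parameters -/

/-- Since `r < q`, the smaller value is at most `2 * L ^ i * q`, while the larger is at least `L * L
^ i * q`; the bound on `L` separates the two intervals. -/
theorem not_isApproximation_of_lt {ε v : ℝ} (hε : 0 < ε) (hε' : ε < 1) {L q r i j : ℕ}
    (hL : 2 * (1 + ε) < L * (1 - ε)) (hr : r < q) (hij : i < j)
    (hi : IsApproximation ε (L ^ i * q + r : ℕ) v) :
    ¬ IsApproximation ε (L ^ j * q + r : ℕ) v := by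
  intro hj
  have hL1 : (1 : ℝ) < L := by nlinarith
  have hLi : (1 : ℝ) ≤ (L : ℝ) ^ i := one_le_pow₀ hL1.le
  have hLj : (L : ℝ) ^ i * L ≤ (L : ℝ) ^ j := by
    rw [← pow_succ]
    exact pow_le_pow_right₀ hL1.le hij
  have hq : (0 : ℝ) < q := by exact_mod_cast (Nat.zero_le r).trans_lt hr
  have hrq : (r : ℝ) ≤ q := by exact_mod_cast hr.le
  have hr0 : (0 : ℝ) ≤ r := r.cast_nonneg
  have h := hj.1.trans hi.2
  push_cast at h
  have h1 : (1 - ε) * ((L : ℝ) ^ i * L * q) ≤ (1 - ε) * ((L : ℝ) ^ j * q + r) := by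
    refine mul_le_mul_of_nonneg_left ?_ (by linarith)
    nlinarith
  have h2 : (1 + ε) * ((L : ℝ) ^ i * q + r) ≤ (1 + ε) * (2 * ((L : ℝ) ^ i * q)) := by
    refine mul_le_mul_of_nonneg_left ?_ (by linarith)
    nlinarith
  have h3 : 0 < (L : ℝ) ^ i * q := by positivity
  nlinarith

/-- The sizes of the parts of the hard instances. -/
theorem exists_block_sizes {κ : ℝ} (hκ : κ < 1 / 4) (k s : ℕ) :
    ∃ α : ℝ, 0 < α ∧ ∃ N₀ : ℕ, ∀ N : ℕ, N₀ ≤ N → ∀ n : ℕ, 1 ≤ n → (n : ℝ) ≤ κ * (N : ℝ) ^ 2 →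
      ∃ p q r m h : ℕ, n = p * q + r ∧ r < q ∧ α * N ≤ m ∧
        h + p + s + (k + 1) * m + q + 3 = N := by
  -- Both `q = Nat.sqrt n` and `p = n / q` are at most about `σ * N`. Of the remaining `(1 - 2 * σ)
  -- * N`, half goes to the `k + 1` copies of `m` and half absorbs constants. A negative `κ` admits
  -- no `n`.
  set σ : ℝ := √κ with hσ
  have hσ2 : σ < 1 / 2 := by
    rw [hσ, Real.sqrt_lt' (by norm_num)]
    linarith
  have hk : (0 : ℝ) < k + 1 := by positivity
  set β : ℝ := (1 - 2 * σ) / (2 * (k + 1)) with hβ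
  have hβ0 : 0 < β := div_pos (by linarith) (by positivity)
  have hβk : (k + 1) * β = (1 - 2 * σ) / 2 := by
    rw [hβ]
    field_simp
  obtain ⟨N₁, hN₁⟩ := exists_nat_gt (1 / (β / 2))
  obtain ⟨N₂, hN₂⟩ := exists_nat_gt ((s + 5) / ((1 - 2 * σ) / 2))
  -- `N₁` pays for rounding `β * N` down, `N₂` for `s + 5`, where 5 is the explicit 3 plus the 2 in
  -- `p ≤ q + 2`.
  refine ⟨β / 2, by positivity, max N₁ N₂, fun N hN n hn hnN => ?_⟩
  have h1 : 1 ≤ β / 2 * N := by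
    have : (N₁ : ℝ) ≤ N := by exact_mod_cast (le_max_left _ _).trans hN
    rw [div_lt_iff₀ (by positivity)] at hN₁
    nlinarith
  have h2 : (s + 5 : ℝ) ≤ (1 - 2 * σ) / 2 * N := by
    have : (N₂ : ℝ) ≤ N := by exact_mod_cast (le_max_right _ _).trans hN
    rw [div_lt_iff₀ (by linarith)] at hN₂
    nlinarith
  have hq : 0 < Nat.sqrt n := Nat.sqrt_pos.2 hn
  have hp : n / Nat.sqrt n ≤ Nat.sqrt n + 2 := by
    have := Nat.sqrt_le_add n
    rw [Nat.div_le_iff_le_mul_add_pred hq]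
    nlinarith
  have hqN : (Nat.sqrt n : ℝ) ≤ σ * N := by
    have h3 : ((Nat.sqrt n : ℝ)) ^ 2 ≤ κ * (N : ℝ) ^ 2 := by
      refine le_trans ?_ hnN
      exact_mod_cast Nat.sqrt_le' n
    have h4 := Real.le_sqrt_of_sq_le h3
    rwa [Real.sqrt_mul' _ (sq_nonneg _), Real.sqrt_sq N.cast_nonneg] at h4
  have hm : (⌊β * N⌋₊ : ℝ) ≤ β * N := Nat.floor_le (by positivity)
  have hm' : β * N < ⌊β * N⌋₊ + 1 := Nat.lt_floor_add_one _
  have hle : n / Nat.sqrt n + s + (k + 1) * ⌊β * N⌋₊ + Nat.sqrt n + 3 ≤ N := by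
    have hp' : ((n / Nat.sqrt n : ℕ) : ℝ) ≤ Nat.sqrt n + 2 := by exact_mod_cast hp
    have h5 : (k + 1 : ℝ) * ⌊β * N⌋₊ ≤ (1 - 2 * σ) / 2 * N := by
      rw [← hβk, mul_assoc]
      gcongr
    have : ((n / Nat.sqrt n : ℕ) : ℝ) + s + (k + 1) * ⌊β * N⌋₊ + Nat.sqrt n + 3 ≤ N := by
      linarith
    exact_mod_cast this
  refine ⟨n / Nat.sqrt n, Nat.sqrt n, n % Nat.sqrt n, ⌊β * N⌋₊,
    N - (n / Nat.sqrt n + s + (k + 1) * ⌊β * N⌋₊ + Nat.sqrt n + 3),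
    (Nat.div_add_mod' _ _).symm, Nat.mod_lt _ hq, by linarith, by lia⟩

/-! ### The lower bound -/

theorem mainTheorem11 (ε δ κ : ℝ) (hε : 0 < ε) (hε' : ε < 1) (hδ : 0 < δ) (hδ' : δ < 1)
    (hκ : κ < 1 / 4) :
    ∃ c : ℝ, 0 < c ∧ ∃ N₀ : ℕ, ∀ N : ℕ, N₀ ≤ N →
      ∀ A B C D E : Type,
        (N : ℕ∞) ≤ ENat.card A → (N : ℕ∞) ≤ ENat.card B → (N : ℕ∞) ≤ ENat.card C →
        (N : ℕ∞) ≤ ENat.card D → (N : ℕ∞) ≤ ENat.card E →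
      ∀ 𝒜 : ChainAlgorithm A B C D E, ApproximatelyCounts 𝒜 N ε δ →
      ∀ OUT : ℕ, 1 ≤ OUT → (OUT : ℝ) ≤ κ * (N : ℝ) ^ 2 →
        ∃ I : ChainInstance A B C D E, I.inputSize = N ∧ I.outputSize = OUT ∧
          ENNReal.ofReal (c * N) ≤ 𝒜.expectedTime I := by
  obtain ⟨K, hK⟩ := exists_nat_gt (2 / (1 - δ))
  obtain ⟨L, hL⟩ := exists_nat_gt (2 * (1 + ε) / (1 - ε))
  rw [div_lt_iff₀ (by linarith)] at hK hL
  -- Three errors of size `η` occur (one running probability, two distances), together half of `1 -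
  -- δ`.
  set η : ℝ := (1 - δ) / 6 with hη
  have hη0 : 0 < η := by rw [hη]; linarith
  -- There are `K + 2` blocks, and the third relation uses two more copies of `m`: in total `(K + 3)
  -- + 1`.
  obtain ⟨α, hα, N₁, hsizes⟩ := exists_block_sizes hκ (K + 3) (∑ i : Fin K, L ^ (i : ℕ))
  obtain ⟨N₂, hN₂⟩ := exists_nat_gt (8 / (η * α))
  rw [div_lt_iff₀ (by positivity)] at hN₂
  refine ⟨η * (η * α / 8), by positivity, max N₁ N₂, ?_⟩
  intro N hN A B C D E hA hB hC hD hE 𝒜 h𝒜 OUT hOUT hOUT'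
  have hN' : 8 < N * (η * α) := by
    have : (N₂ : ℝ) ≤ N := by exact_mod_cast (le_max_right _ _).trans hN
    exact hN₂.trans_le (by gcongr)
  obtain ⟨p, q, r, m, h, rfl, hrq, hm, hsum⟩ := hsizes N ((le_max_left _ _).trans hN) OUT hOUT hOUT'
  have hm0 : 0 < m := by
    have : (0 : ℝ) < m := by nlinarith
    exact_mod_cast this
  -- The largest time for which `4 * T / m ≤ η`.
  set T : ℕ := ⌊η * m / 4⌋₊ with hT
  have hT1 : (T : ℝ) ≤ η * m / 4 := Nat.floor_le (by positivity)
  have hT2 : η * α / 8 * N ≤ T := by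
    have h1 : η * m / 4 < T + 1 := Nat.lt_floor_add_one _
    have h2 : η * (α * N) ≤ η * m := by gcongr
    linarith
  -- Block `none` pads the input size to exactly `N`, block `some none` realizes `OUT`, and the
  -- others give the `K` competing outputs.
  obtain ⟨J, hJ⟩ := ChainAlgorithm.exists_close_instances (ι := Option (Option (Fin K)))
    hA hB hC hD hE (fun o => o.elim h fun o => o.elim p fun i => L ^ (i : ℕ)) hm0 hrq.le
    (by
      rw [← hsum]
      simp only [Fintype.sum_option, Option.elim_none, Option.elim_some, Fintype.card_option,
        Fintype.card_fin]
      ring) 𝒜 T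
  choose I hIN hIout hI using hJ
  refine ⟨I (some none), hIN _, hIout _, ?_⟩
  by_contra! hlt
  have hd : (4 * T / m : ℝ≥0∞) ≤ ENNReal.ofReal η := by
    refine ENNReal.div_le_of_le_mul ?_
    rw [← ENNReal.ofReal_natCast m, ← ENNReal.ofReal_mul hη0.le]
    calc (4 * T : ℝ≥0∞) = ENNReal.ofReal (4 * T) := by
          rw [ENNReal.ofReal_mul (by norm_num), ENNReal.ofReal_natCast]
          norm_num
      _ ≤ _ := ENNReal.ofReal_le_ofReal (by linarith)
  have hrun : (𝒜.config (I (some none)) T).toOuterMeasure (Set.range Sum.inl)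
      ≤ ENNReal.ofReal η := by
    by_contra! hgt
    refine (hlt.trans_le ?_).not_ge (𝒜.mul_running_le_expectedTime (I (some none)) T)
    calc ENNReal.ofReal (η * (η * α / 8) * N) ≤ ENNReal.ofReal (T * η) :=
          ENNReal.ofReal_le_ofReal (by nlinarith)
      _ = T * ENNReal.ofReal η := by
          rw [ENNReal.ofReal_mul (by positivity), ENNReal.ofReal_natCast]
      _ ≤ _ := by gcongr
  have hmain := 𝒜.card_mul_le_of_close (hI (some none)) (fun i : Fin K => hI (some (some i)))
    (S := fun i => {v | IsApproximation ε (I (some (some i))).outputSize v})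
    (ρ := ENNReal.ofReal (1 - δ)) (by
      intro i j v hi hj
      simp only [Set.mem_ofPred_eq, hIout] at hi hj
      by_contra hij
      rcases lt_or_gt_of_ne hij with hij | hij
      · exact not_isApproximation_of_lt hε hε' hL hrq hij hi hj
      · exact not_isApproximation_of_lt hε hε' hL hrq hij hj hi)
    (fun i => h𝒜 _ (hIN _) (by
      rw [hIout]
      have hL0 : 0 < L := by
        have : (0 : ℝ) < L := by nlinarith
        exact_mod_cast this
      have : 0 < L ^ (i : ℕ) * q := Nat.mul_pos (pow_pos hL0 _) (by lia)
      simp only [Option.elim_some]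
      lia))
  rw [Fintype.card_fin] at hmain
  have hfin : (K : ℝ≥0∞) * ENNReal.ofReal (1 - δ) ≤
      1 + K * (ENNReal.ofReal η + ENNReal.ofReal η + ENNReal.ofReal η) :=
    hmain.trans (by gcongr)
  rw [← ENNReal.ofReal_add hη0.le hη0.le, ← ENNReal.ofReal_add (by linarith) hη0.le,
    ← ENNReal.ofReal_natCast, ← ENNReal.ofReal_mul (by positivity),
    ← ENNReal.ofReal_mul (by positivity), ← ENNReal.ofReal_one,
    ← ENNReal.ofReal_add zero_le_one (by positivity),
    ENNReal.ofReal_le_ofReal_iff (by positivity)] at hfin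
  -- Now `K * (1 - δ) ≤ 1 + K * (1 - δ) / 2`, contrary to `K * (1 - δ) > 2`.
  rw [hη] at hfin
  linarith
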